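/- Let $n,p\ge 0$ be integers, let $\mathbf X\in\mathbf R^{n\times p}$ be deterministic, $\beta^*\in\mathbf R^p$, $\sigma>0$, and let $y=\mathbf X\beta^*+\varepsilon$ with $\varepsilon\sim N(0,\sigma^2 I_{n\times n})$. Let $h:\mathbf R^p\to[0,+\infty]$ be convex and proper (that is, $h(\beta)<+\infty$ for at least one $\beta$), and such that for every $y'\in\mathbf R^n$ and every $\mathbf X'\in\mathbf R^{n\times p}$ the problem $\min_{\beta\in\mathbf R^p}\|\mathbf X'\beta-y'\|^2+2h(\beta)$ has at least one solution, where $\|\cdot\|$ is the Euclidean norm. Let $$\hat\beta\in\operatorname*{argmin}_{\beta\in\mathbf R^p}\ \|\mathbf X\beta-y\|^2+2h(\beta)$$ for every realization of $\varepsilon$, and let $\hat r=\|\mathbf X(\hat\beta-\beta^*)\|$ be the prediction error. Assume that the infimum $$t_c=\inf_{\beta\in\mathbf R^p:\ h(\beta)<+\infty}\|\mathbf X(\beta-\beta^*)\|$$ is attained. For $t\ge0$ define $$F(t)=\sup_{\beta\in\mathbf R^p:\ \|\mathbf X(\beta-\beta^*)\|\le t}\bigl(\varepsilon^T\mathbf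 X(\beta-\beta^*)-h(\beta)\bigr)-\frac{t^2}{2}\in[-\infty,+\infty),\qquad f(t)=\mathbf E[F(t)]\in[-\infty,+\infty),$$ where the supremum over the empty set is $-\infty$. Then $f$ has a unique maximizer $t_f$ over $[0,+\infty)$, the random variable $\hat r$ is integrable, and $$\bigl|\sqrt{t_f}-\sqrt m\bigr|\le\sqrt{21\sigma/2}\le 3.25\sqrt\sigma,$$ $$\Bigl|\sqrt{t_f}-\sqrt{\mathbf E[\hat r]}\Bigr|\le\sqrt\sigma\,\Bigl(\sqrt{21/2}+(\pi/2)^{1/4}\Bigr)\le 4.40\sqrt\sigma,$$ where $m$ is the median of $\hat r$, i.e. a real number with $\mathbf P(\hat r\le m)\ge\frac12$ and $\mathbf P(\hat r\ge m)\ge\frac12$. -/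

import Mathlib

open Set MeasureTheory ProbabilityTheory
open scoped NNReal ENNReal

noncomputable section

namespace PenalizedLS

variable {n p : ℕ}

/-- The least-squares objective `‖Xβ - y‖² + 2 h(β)`, with values in `[0, +∞]`. -/
def objective (X : Matrix (Fin n) (Fin p) ℝ) (h : EuclideanSpace ℝ (Fin p) → ℝ≥0∞)
    (y : EuclideanSpace ℝ (Fin n)) (β : EuclideanSpace ℝ (Fin p)) : ℝ≥0∞ :=
  ENNReal.ofReal (‖X.toEuclideanLin β - y‖ ^ 2) + 2 * h β

/-- `b` is a solution of the minimization problem `min_β ‖Xβ - y‖² + 2 h(β)` over all `β`. -/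
def IsSolution (X : Matrix (Fin n) (Fin p) ℝ) (h : EuclideanSpace ℝ (Fin p) → ℝ≥0∞)
    (y : EuclideanSpace ℝ (Fin n)) (b : EuclideanSpace ℝ (Fin p)) : Prop :=
  ∀ β, objective X h y b ≤ objective X h y β

/-- The effective domain of `h`. -/
def dom (h : EuclideanSpace ℝ (Fin p) → ℝ≥0∞) : Set (EuclideanSpace ℝ (Fin p)) :=
  {β | h β < ⊤}

/-- The standing assumption on the penalty (for sample size `n`): it is convex, proper, and the
penalized least-squares problem has a solution for all data `y` and all designs `X`. -/
structure IsPenalty (n : ℕ) (h : EuclideanSpace ℝ (Fin p) → ℝ≥0∞) : Prop where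
  convex : ConvexOn ℝ≥0 univ h
  proper : (dom h).Nonempty
  solvable : ∀ (X : Matrix (Fin n) (Fin p) ℝ) (y : EuclideanSpace ℝ (Fin n)),
    ∃ b, IsSolution X h y b

/-- The prediction error `‖X(β - β*)‖` of `β`. -/
def predError (X : Matrix (Fin n) (Fin p) ℝ) (βs β : EuclideanSpace ℝ (Fin p)) : ℝ :=
  ‖X.toEuclideanLin (β - βs)‖

/-- `t_c`, the infimum of `‖X(β - β*)‖` over the effective domain of `h`. -/
def tc (X : Matrix (Fin n) (Fin p) ℝ) (h : EuclideanSpace ℝ (Fin p) → ℝ≥0∞)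
    (βs : EuclideanSpace ℝ (Fin p)) : ℝ :=
  sInf (predError X βs '' dom h)

/-- `F(t) = sup_{β : ‖X(β - β*)‖ ≤ t} (εᵀX(β - β*) - h(β)) - t²/2` for the noise vector `e`, as an
extended real; the supremum over the empty set is `-∞`. -/
def F (X : Matrix (Fin n) (Fin p) ℝ) (h : EuclideanSpace ℝ (Fin p) → ℝ≥0∞)
    (βs : EuclideanSpace ℝ (Fin p)) (e : EuclideanSpace ℝ (Fin n)) (t : ℝ) : EReal :=
  (⨆ β ∈ {β : EuclideanSpace ℝ (Fin p) | predError X βs β ≤ t},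
    ((inner ℝ e (X.toEuclideanLin (β - βs)) : ℝ) : EReal) - (h β : EReal))
    - ((t ^ 2 / 2 : ℝ) : EReal)

variable {Ω : Type*} [MeasurableSpace Ω]

/-- Expectation `E[Y⁺] - E[Y⁻]` of an extended-real random variable. -/
def extExpectation (P : Measure Ω) (Y : Ω → EReal) : EReal :=
  ((∫⁻ ω, (Y ω).toENNReal ∂P : ℝ≥0∞) : EReal) - ((∫⁻ ω, (-Y ω).toENNReal ∂P : ℝ≥0∞) : EReal)

/-- `f(t) = E[F(t)]`, the expectation being over the noise `ε`. -/
def f (P : Measure Ω) (ε : Ω → EuclideanSpace ℝ (Fin n)) (X : Matrix (Fin n) (Fin p) ℝ)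
    (h : EuclideanSpace ℝ (Fin p) → ℝ≥0∞) (βs : EuclideanSpace ℝ (Fin p)) (t : ℝ) : EReal :=
  extExpectation P (fun ω => F X h βs (ε ω) t)

/-- `t` maximizes `g` over `[0, +∞)`. -/
def IsMaximizer (g : ℝ → EReal) (t : ℝ) : Prop :=
  0 ≤ t ∧ IsMaxOn g (Ici 0) t

/-- `m` is a median of the real random variable `Y`. -/
def IsMedian (P : Measure Ω) (Y : Ω → ℝ) (m : ℝ) : Prop :=
  1 / 2 ≤ P {ω | Y ω ≤ m} ∧ 1 / 2 ≤ P {ω | m ≤ Y ω}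

end PenalizedLS

end

open Filter Topology

namespace PenalizedLS

/-! ### Gaussian Poincaré inequality for Lipschitz functions -/

/-! Write `u = X(β - β*)` for `β` in the domain of `h`, let `G_e(t)` be the supremum of `⟪e, u⟫ - h`
over `‖u‖ ≤ t`, and put `F_e(t) = G_e(t) - t²/2`. Minimality of the estimator gives a variational
inequality, from which `F_e(t) ≤ F_e(r) - (t - r)²/2` with `r` the prediction error: `r` maximizes
the random function whose mean `t_f` maximizes. Since `G_e` is concave on `[t_c, ∞)`, the bound
becomes `F_e(t) ≤ F_e(m) - (t - m)²/2` for every `m` between `r` and `t`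
(`IsProx.ballSup_sub_le_of_between`).

Take `t = t_f` and `m` a median of `r`. With probability at least 1/2, `m` lies between `r` and
`t_f`; as `f(m) ≤ f(t_f)`, on that event `G(m) - G(t_f)` exceeds its mean by at least `(t_f -
m)²/2`. This difference is `(m + t_f)`-Lipschitz in the noise, so a Gaussian Poincaré inequality
with constant `π²/8` and Chebyshev's inequality give `(t_f - m)² ≤ πσ(t_f + m)`, that is `|√t_f -
√m| ≤ √(πσ)` (`sq_sub_le_of_isMedian`). The prediction error is itself 1-Lipschitz in the noise, so
the same deviation bound compares its median and mean.

Uniqueness of `t_f` comes from the term `-t²/2`. Existence is delicate only at `t_c`, where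
concavity does not give upper semicontinuity; `exists_isMaxOn_meanCriterion` distinguishes whether
some noise vector has a solution of prediction error exactly `t_c`. -/

theorem pi_absolutelyContinuous {n : ℕ} (μ ν : Fin n → Measure ℝ)
    [∀ i, SigmaFinite (μ i)] [∀ i, SigmaFinite (ν i)] (h : ∀ i, μ i ≪ ν i) :
    Measure.pi μ ≪ Measure.pi ν := by
  induction n with
  | zero => rw [Measure.pi_of_empty, Measure.pi_of_empty]
  | succ n ih =>
    have hμ := (measurePreserving_piFinSuccAbove μ 0).symm
    have hν := (measurePreserving_piFinSuccAbove ν 0).symm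
    rw [← hμ.map_eq, ← hν.map_eq]
    exact ((h 0).prod (ih _ _ fun i => h _)).map hμ.measurable

/-- Carries Rademacher's theorem from Lebesgue measure to the Gaussian. -/
theorem stdGaussian_absolutelyContinuous (n : ℕ) :
    stdGaussian (EuclideanSpace ℝ (Fin n)) ≪ volume := by
  rw [← map_pi_eq_stdGaussian, ← (PiLp.volume_preserving_toLp (Fin n)).map_eq]
  refine (pi_absolutelyContinuous _ _ fun i => ?_).map (by fun_prop)
  exact gaussianReal_absolutelyContinuous 0 one_ne_zero

section Poincare

variable {n : ℕ} {φ : EuclideanSpace ℝ (Fin n) → ℝ} {K : ℝ≥0}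

theorem memLp_two_of_lipschitz {Ω E : Type*} [MeasurableSpace Ω] {P : Measure Ω}
    [IsFiniteMeasure P] [NormedAddCommGroup E] [MeasurableSpace E] [BorelSpace E]
    [SecondCountableTopology E] {ε : Ω → E} (hε : MemLp ε 2 P) {φ : E → ℝ}
    (hφ : LipschitzWith K φ) : MemLp (fun ω => φ (ε ω)) 2 P := by
  have h : MemLp (fun ω => K * ‖ε ω‖ + ‖φ 0‖) 2 P := (hε.norm.const_mul _).add (memLp_const _)
  refine h.mono' (hφ.continuous.comp_aestronglyMeasurable hε.1) (ae_of_all _ fun ω => ?_)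
  have := hφ.dist_le_mul (ε ω) 0
  rw [dist_eq_norm, dist_zero_right] at this
  linarith [norm_sub_norm_le (φ (ε ω)) (φ 0)]

/-- `(x, y) ↦ cos θ • x + sin θ • y`. -/
noncomputable def rot (θ : ℝ) (p : EuclideanSpace ℝ (Fin n) × EuclideanSpace ℝ (Fin n)) :
    EuclideanSpace ℝ (Fin n) :=
  Real.cos θ • p.1 + Real.sin θ • p.2

@[fun_prop]
theorem continuous_rot (θ : ℝ) : Continuous (rot (n := n) θ) := by
  unfold rot; fun_prop

theorem rot_rotation (θ η : ℝ) (p : EuclideanSpace ℝ (Fin n) × EuclideanSpace ℝ (Fin n)) :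
    rot θ (ContinuousLinearMap.rotation η p) = rot (η + θ) p := by
  simp only [rot, ContinuousLinearMap.rotation_apply, Real.cos_add, Real.sin_add]
  module

theorem measurePreserving_rotation (θ : ℝ) :
    MeasurePreserving (ContinuousLinearMap.rotation (E := EuclideanSpace ℝ (Fin n)) θ)
      ((stdGaussian _).prod (stdGaussian _)) ((stdGaussian _).prod (stdGaussian _)) :=
  ⟨by fun_prop, IsGaussian.map_rotation_eq_self (by simp) θ⟩

/-- The factor `|θ|` cancels the number of rotation steps, which yields a dominating function
uniform in that number. -/
theorem abs_sub_rot_le (hφ : LipschitzWith K φ) (θ : ℝ)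
    (p : EuclideanSpace ℝ (Fin n) × EuclideanSpace ℝ (Fin n)) :
    |φ p.1 - φ (rot θ p)| ≤ K * (|θ| * (‖p.1‖ + ‖p.2‖)) := by
  refine (Real.dist_eq _ _ ▸ hφ.dist_le_mul _ _).trans ?_
  gcongr
  have h1 : |1 - Real.cos θ| ≤ |θ| := by
    simpa using Real.abs_cos_sub_cos_le 0 θ
  have h2 : |Real.sin θ| ≤ |θ| := Real.abs_sin_le_abs
  rw [dist_eq_norm, show p.1 - rot θ p = (1 - Real.cos θ) • p.1 - Real.sin θ • p.2 by
    unfold rot; module]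
  refine (norm_sub_le _ _).trans ?_
  rw [norm_smul, norm_smul, mul_add, Real.norm_eq_abs, Real.norm_eq_abs]
  gcongr

theorem memLp_rot (θ : ℝ) :
    MemLp (rot (n := n) θ) 2
      ((stdGaussian (EuclideanSpace ℝ (Fin n))).prod (stdGaussian (EuclideanSpace ℝ (Fin n)))) := by
  have h := IsGaussian.memLp_two_fun_id (μ := stdGaussian (EuclideanSpace ℝ (Fin n)))
  have h1 := (h.comp_fst (stdGaussian (EuclideanSpace ℝ (Fin n)))).const_smul (Real.cos θ)
  have h2 := (h.comp_snd (stdGaussian (EuclideanSpace ℝ (Fin n)))).const_smul (Real.sin θ)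
  exact h1.add h2

theorem memLp_sub_rot (hφ : LipschitzWith K φ) (θ η : ℝ) :
    MemLp (fun p => φ (rot θ p) - φ (rot η p)) 2
      ((stdGaussian (EuclideanSpace ℝ (Fin n))).prod (stdGaussian (EuclideanSpace ℝ (Fin n)))) :=
  (memLp_two_of_lipschitz (memLp_rot θ) hφ).sub (memLp_two_of_lipschitz (memLp_rot η) hφ)

/-- Telescope along `N` rotations by `θ` and apply Cauchy–Schwarz; rotation invariance of the
product Gaussian makes all increments equal in law. -/
theorem integral_sq_sub_le_mul (hφ : LipschitzWith K φ) (N : ℕ) (θ : ℝ) :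
    ∫ p, (φ (rot 0 p) - φ (rot (N * θ) p)) ^ 2
        ∂(stdGaussian (EuclideanSpace ℝ (Fin n))).prod (stdGaussian _)
      ≤ ∫ p, (N * (φ p.1 - φ (rot θ p))) ^ 2
        ∂(stdGaussian (EuclideanSpace ℝ (Fin n))).prod (stdGaussian _) := by
  have hstep (k : ℕ) : ∫ p, (φ (rot (k * θ) p) - φ (rot ((k + 1 : ℕ) * θ) p)) ^ 2
        ∂(stdGaussian (EuclideanSpace ℝ (Fin n))).prod (stdGaussian _)
      = ∫ p, (φ p.1 - φ (rot θ p)) ^ 2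
        ∂(stdGaussian (EuclideanSpace ℝ (Fin n))).prod (stdGaussian _) := by
    have hc := hφ.continuous
    conv_rhs => rw [← (measurePreserving_rotation (n := n) (k * θ)).map_eq]
    rw [integral_map (by fun_prop) (Continuous.aestronglyMeasurable (by fun_prop))]
    refine integral_congr_ae (ae_of_all _ fun p => ?_)
    simp only [rot_rotation]
    have : (ContinuousLinearMap.rotation (k * θ) p).1 = rot (k * θ) p := rfl
    rw [this]
    push_cast
    rw [add_mul, one_mul]
  calc _ ≤ ∫ p, N * ∑ k ∈ Finset.range N, (φ (rot (k * θ) p) - φ (rot ((k + 1 : ℕ) * θ) p)) ^ 2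
        ∂(stdGaussian (EuclideanSpace ℝ (Fin n))).prod (stdGaussian _) := by
        refine integral_mono (memLp_sub_rot hφ _ _).integrable_sq ?_ fun p => ?_
        · exact (integrable_finsetSum _ fun k _ =>
            (memLp_sub_rot hφ _ _).integrable_sq).const_mul _
        · have h := Finset.sum_range_sub' (fun k : ℕ => φ (rot (k * θ) p)) N
          have h2 := sq_sum_le_card_mul_sum_sq (s := Finset.range N)
            (f := fun k : ℕ => φ (rot (k * θ) p) - φ (rot ((k + 1 : ℕ) * θ) p))
          rw [h] at h2
          simpa using h2
    _ = _ := by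
        rw [integral_const_mul, integral_finsetSum _ fun k _ =>
          (memLp_sub_rot hφ _ _).integrable_sq]
        simp_rw [hstep, mul_pow]
        rw [integral_const_mul]
        simp only [Finset.sum_const, Finset.card_range, nsmul_eq_mul]
        ring

theorem tendsto_mul_sub_rot {x : EuclideanSpace ℝ (Fin n)} (hx : DifferentiableAt ℝ φ x)
    (y : EuclideanSpace ℝ (Fin n)) :
    Tendsto (fun N : ℕ => ((N + 1 : ℕ) : ℝ) *
      (φ x - φ (rot (Real.pi / 2 / ((N + 1 : ℕ) : ℝ)) (x, y)))) atTop
      (𝓝 (-(Real.pi / 2 * fderiv ℝ φ x y))) := by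
  have hd : HasDerivAt (fun θ : ℝ => φ (rot θ (x, y))) (fderiv ℝ φ x y) 0 := by
    have h1 : HasDerivAt (fun θ : ℝ => rot θ (x, y)) y 0 := by
      have := ((Real.hasDerivAt_cos 0).smul_const x).add ((Real.hasDerivAt_sin 0).smul_const y)
      simpa [rot] using! this
    have h0 : rot 0 (x, y) = x := by simp [rot]
    have h2 : HasFDerivAt φ (fderiv ℝ φ x) (rot 0 (x, y)) := by
      rw [h0]; exact hx.hasFDerivAt
    exact h2.comp_hasDerivAt 0 h1
  -- The index `N + 1` keeps the angle nonzero, as the punctured limit of slopes requires.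
  have hlim : Tendsto (fun N : ℕ => Real.pi / 2 / ((N + 1 : ℕ) : ℝ)) atTop (𝓝[≠] 0) := by
    refine tendsto_nhdsWithin_iff.2 ⟨?_, ?_⟩
    · exact (tendsto_const_div_atTop_nhds_zero_nat (Real.pi / 2)).comp (tendsto_add_atTop_nat 1)
    · exact Eventually.of_forall fun N => by
        have := Real.pi_pos
        simp only [mem_compl_iff, mem_singleton_iff]
        positivity
  have := ((hasDerivAt_iff_tendsto_slope.1 hd).comp hlim).const_mul (-(Real.pi / 2))
  rw [neg_mul] at this
  refine this.congr fun N => ?_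
  have := Real.pi_pos
  have h0 : rot 0 (x, y) = x := by simp [rot]
  simp only [Function.comp, slope_def_field, h0, sub_zero]
  field_simp
  ring

theorem integral_sq_strongDual (L : StrongDual ℝ (EuclideanSpace ℝ (Fin n))) :
    ∫ y, L y ^ 2 ∂stdGaussian (EuclideanSpace ℝ (Fin n)) = ‖L‖ ^ 2 := by
  rw [← variance_dual_stdGaussian L, variance_eq_integral (by fun_prop)]
  simp

/-- A quarter turn carries `x` to `y`. As the number of steps grows, the telescoped bound tends to
the second moment of `(π/2) ∇φ(x)·y`, and integrating over `y` leaves `(π/2)² ‖∇φ(x)‖²`. -/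
theorem integral_sq_sub_le (hφ : LipschitzWith K φ) :
    ∫ p, (φ p.1 - φ p.2) ^ 2 ∂(stdGaussian (EuclideanSpace ℝ (Fin n))).prod (stdGaussian _)
      ≤ Real.pi ^ 2 / 4 * K ^ 2 := by
  set γ := stdGaussian (EuclideanSpace ℝ (Fin n)) with hγ
  have hc := hφ.continuous
  have hpi := Real.pi_pos
  have hdiff : ∀ᵐ p ∂γ.prod γ, DifferentiableAt ℝ φ p.1 :=
    Measure.quasiMeasurePreserving_fst.ae
      ((stdGaussian_absolutelyContinuous n).ae_le hφ.ae_differentiableAt)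
  have hmeas : Measurable fun p : EuclideanSpace ℝ (Fin n) × EuclideanSpace ℝ (Fin n) =>
      (fderiv ℝ φ p.1 p.2 : ℝ) := by
    have h1 : Measurable fun p : EuclideanSpace ℝ (Fin n) × EuclideanSpace ℝ (Fin n) =>
        fderiv ℝ φ p.1 := (measurable_fderiv ℝ φ).comp measurable_fst
    exact (isBoundedBilinearMap_apply (𝕜 := ℝ)).continuous.measurable.comp
      (h1.prodMk measurable_snd)
  have hb : Integrable (fun p : EuclideanSpace ℝ (Fin n) × EuclideanSpace ℝ (Fin n) =>
      (Real.pi / 2 * K * (‖p.1‖ + ‖p.2‖)) ^ 2) (γ.prod γ) := by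
    refine MemLp.integrable_sq ?_
    refine MemLp.const_mul ?_ _
    exact (IsGaussian.memLp_two_id.norm.comp_fst γ).add (IsGaussian.memLp_two_id.norm.comp_snd γ)
  have hlim := tendsto_integral_of_dominated_convergence (μ := γ.prod γ)
    (F := fun (N : ℕ) p => (((N + 1 : ℕ) : ℝ) *
      (φ p.1 - φ (rot (Real.pi / 2 / ((N + 1 : ℕ) : ℝ)) p))) ^ 2)
    (f := fun p => (-(Real.pi / 2 * fderiv ℝ φ p.1 p.2)) ^ 2) _
    (fun N => Continuous.aestronglyMeasurable (by fun_prop)) hb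
    (fun N => ae_of_all _ fun p => by
      rw [Real.norm_eq_abs, abs_of_nonneg (sq_nonneg _), ← sq_abs]
      refine pow_le_pow_left₀ (abs_nonneg _) ?_ 2
      rw [abs_mul, abs_of_nonneg (Nat.cast_nonneg _)]
      calc _ ≤ ((N + 1 : ℕ) : ℝ) *
            (K * (|Real.pi / 2 / ((N + 1 : ℕ) : ℝ)| * (‖p.1‖ + ‖p.2‖))) := by
            gcongr; exact abs_sub_rot_le hφ _ p
        _ = _ := by
            rw [abs_of_pos (by positivity)]
            field_simp)
    (by
      filter_upwards [hdiff] with p hp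
      exact (tendsto_mul_sub_rot hp p.2).pow 2)
  have hle : ∫ p, (φ p.1 - φ p.2) ^ 2 ∂γ.prod γ
      ≤ ∫ p, (-(Real.pi / 2 * fderiv ℝ φ p.1 p.2)) ^ 2 ∂γ.prod γ := by
    refine ge_of_tendsto' hlim fun N => ?_
    have := integral_sq_sub_le_mul hφ (N + 1) (Real.pi / 2 / ((N + 1 : ℕ) : ℝ))
    rw [mul_div_cancel₀ _ (by positivity)] at this
    simpa [rot] using this
  refine hle.trans ?_
  have hint : Integrable (fun p : EuclideanSpace ℝ (Fin n) × EuclideanSpace ℝ (Fin n) =>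
      (-(Real.pi / 2 * fderiv ℝ φ p.1 p.2)) ^ 2) (γ.prod γ) := by
    refine hb.mono' ((hmeas.const_mul _).neg.pow_const 2).aestronglyMeasurable
      (ae_of_all _ fun p => ?_)
    rw [Real.norm_eq_abs, abs_of_nonneg (sq_nonneg _), ← sq_abs, abs_neg]
    refine pow_le_pow_left₀ (abs_nonneg _) ?_ 2
    rw [abs_mul, abs_of_pos (by positivity), mul_assoc]
    gcongr
    calc |fderiv ℝ φ p.1 p.2| ≤ ‖fderiv ℝ φ p.1‖ * ‖p.2‖ := (fderiv ℝ φ p.1).le_opNorm _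
      _ ≤ K * (‖p.1‖ + ‖p.2‖) := by
        gcongr
        · exact norm_fderiv_le_of_lipschitz ℝ hφ
        · linarith [norm_nonneg p.1]
  rw [integral_prod _ hint]
  have hin (x : EuclideanSpace ℝ (Fin n)) :
      ∫ y, (-(Real.pi / 2 * fderiv ℝ φ x y)) ^ 2 ∂γ ≤ Real.pi ^ 2 / 4 * K ^ 2 := by
    have : ∀ y, (-(Real.pi / 2 * fderiv ℝ φ x y)) ^ 2
        = Real.pi ^ 2 / 4 * (fderiv ℝ φ x y) ^ 2 := fun y => by ring
    simp_rw [this]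
    rw [integral_const_mul, integral_sq_strongDual]
    gcongr
    exact norm_fderiv_le_of_lipschitz ℝ hφ
  calc _ ≤ ∫ _, Real.pi ^ 2 / 4 * (K : ℝ) ^ 2 ∂γ :=
        integral_mono hint.integral_prod_left (integrable_const _) hin
    _ = _ := by simp

/-- The mean squared difference of two independent copies is twice the variance. -/
theorem variance_stdGaussian_le (hφ : LipschitzWith K φ) :
    Var[φ; stdGaussian (EuclideanSpace ℝ (Fin n))] ≤ Real.pi ^ 2 / 8 * K ^ 2 := by
  set γ := stdGaussian (EuclideanSpace ℝ (Fin n)) with hγ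
  have hL : MemLp φ 2 γ := memLp_two_of_lipschitz IsGaussian.memLp_two_id hφ
  have h0 : MemLp (fun x => φ x - ∫ z, φ z ∂γ) 2 γ := hL.sub (memLp_const _)
  have hz : ∫ x, (φ x - ∫ z, φ z ∂γ) ∂γ = 0 := by
    rw [integral_sub (hL.integrable one_le_two) (integrable_const _)]
    simp
  have hsq := integral_sq_sub_le hφ
  have heq : ∀ p : EuclideanSpace ℝ (Fin n) × EuclideanSpace ℝ (Fin n),
      (φ p.1 - φ p.2) ^ 2 = (φ p.1 - ∫ z, φ z ∂γ) ^ 2 + (φ p.2 - ∫ z, φ z ∂γ) ^ 2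
        - 2 * ((φ p.1 - ∫ z, φ z ∂γ) * (φ p.2 - ∫ z, φ z ∂γ)) := fun p => by ring
  have hi := h0.integrable_sq
  have hp := (h0.integrable one_le_two).mul_prod (h0.integrable one_le_two)
  simp_rw [heq] at hsq
  have hadd : Integrable (fun p : EuclideanSpace ℝ (Fin n) × EuclideanSpace ℝ (Fin n) =>
      (φ p.1 - ∫ z, φ z ∂γ) ^ 2 + (φ p.2 - ∫ z, φ z ∂γ) ^ 2) (γ.prod γ) :=
    (hi.comp_fst γ).add (hi.comp_snd γ)
  rw [← hγ, integral_sub hadd (hp.const_mul 2),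
    integral_add (hi.comp_fst γ) (hi.comp_snd γ), integral_const_mul,
    integral_prod_mul (fun x => φ x - ∫ z, φ z ∂γ) (fun x => φ x - ∫ z, φ z ∂γ), hz,
    integral_fun_fst (fun x => (φ x - ∫ z, φ z ∂γ) ^ 2),
    integral_fun_snd (fun x => (φ x - ∫ z, φ z ∂γ) ^ 2)] at hsq
  rw [variance_eq_integral hL.1.aemeasurable]
  simp at hsq
  linarith

end Poincare

/-! ### Variance and deviation bounds for noise of level `σ` -/

section Noise

variable {n : ℕ} {Ω : Type*} [MeasurableSpace Ω] {P : Measure Ω} {σ : ℝ}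
  {ε : Ω → EuclideanSpace ℝ (Fin n)}

theorem multivariateGaussian_sq_smul_one (σ : ℝ) :
    multivariateGaussian 0 (σ ^ 2 • (1 : Matrix (Fin n) (Fin n) ℝ))
      = (stdGaussian (EuclideanSpace ℝ (Fin n))).map (fun x => σ • x) := by
  have hps : (σ ^ 2 • (1 : Matrix (Fin n) (Fin n) ℝ)).PosSemidef :=
    Matrix.PosSemidef.one.smul (sq_nonneg σ)
  apply Measure.ext_of_charFun (E := EuclideanSpace ℝ (Fin n))
  ext t
  have key : t.ofLp ⬝ᵥ (σ ^ 2 • (1 : Matrix (Fin n) (Fin n) ℝ)).mulVec t.ofLp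
      = (‖σ‖ * ‖t‖) ^ 2 := by
    rw [mul_pow, EuclideanSpace.real_norm_sq_eq t, Real.norm_eq_abs, sq_abs]
    simp [Matrix.smul_mulVec, dotProduct, Finset.mul_sum]
    refine Finset.sum_congr rfl fun i _ => ?_
    ring
  rw [charFun_multivariateGaussian hps, charFun_map_smul, charFun_stdGaussian, norm_smul, key,
    inner_zero_right]
  push_cast
  congr 1
  ring

variable (hε : HasLaw ε (multivariateGaussian 0 (σ ^ 2 • (1 : Matrix (Fin n) (Fin n) ℝ))) P)
include hε

theorem memLp_noise : MemLp ε 2 P := by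
  have h : MemLp id 2 (P.map ε) := by
    rw [hε.map_eq]; exact IsGaussian.memLp_two_id
  exact h.comp_of_map hε.aemeasurable

theorem variance_noise_le (hσ : 0 < σ) {φ : EuclideanSpace ℝ (Fin n) → ℝ} {K : ℝ≥0}
    (hφ : LipschitzWith K φ) :
    Var[fun ω => φ (ε ω); P] ≤ Real.pi ^ 2 / 8 * (σ * K) ^ 2 := by
  have hc := hφ.continuous
  have hφσ : LipschitzWith (K * σ.toNNReal) fun x : EuclideanSpace ℝ (Fin n) => φ (σ • x) := by
    refine hφ.comp (LipschitzWith.of_dist_le_mul fun x y => ?_)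
    rw [dist_smul₀, Real.coe_toNNReal _ hσ.le, Real.norm_of_nonneg hσ.le]
  have h1 : Var[fun ω => φ (ε ω); P] = Var[φ; P.map ε] :=
    (variance_map (by fun_prop) hε.aemeasurable).symm
  have h2 := variance_stdGaussian_le hφσ
  have h3 : Var[fun x => φ (σ • x); stdGaussian (EuclideanSpace ℝ (Fin n))]
      = Var[φ; (stdGaussian (EuclideanSpace ℝ (Fin n))).map (fun x => σ • x)] :=
    (variance_map (by fun_prop) (by fun_prop)).symm
  rw [h1, hε.map_eq, multivariateGaussian_sq_smul_one σ, ← h3]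
  refine h2.trans_eq ?_
  rw [NNReal.coe_mul, Real.coe_toNNReal _ hσ.le]
  ring

/-- For `a > 0`, Chebyshev gives `a² ≤ 2 Var ≤ (π/2)² (σK)²`. -/
theorem le_of_half_le_measure_deviation [IsProbabilityMeasure P] (hσ : 0 < σ)
    {φ : EuclideanSpace ℝ (Fin n) → ℝ} {K : ℝ≥0} (hφ : LipschitzWith K φ) {a : ℝ}
    (ha : 1 / 2 ≤ P {ω | a ≤ φ (ε ω) - ∫ ω', φ (ε ω') ∂P}) :
    a ≤ Real.pi / 2 * (σ * K) := by
  have hpi := Real.pi_pos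
  rcases le_or_gt a 0 with h0 | h0
  · exact h0.trans (by positivity)
  have h1 := meas_ge_le_variance_div_sq (memLp_two_of_lipschitz (memLp_noise hε) hφ) h0
  have h2 : (1 / 2 : ℝ≥0∞) ≤ ENNReal.ofReal (Var[fun ω => φ (ε ω); P] / a ^ 2) :=
    by
    refine ha.trans (le_trans (measure_mono fun ω hω => ?_) h1)
    exact le_trans (mem_ofPred_eq ▸ hω) (le_abs_self _)
  have h3 : (1 / 2 : ℝ) ≤ Var[fun ω => φ (ε ω); P] / a ^ 2 := by
    rw [ENNReal.le_ofReal_iff_toReal_le (by simp) (div_nonneg (variance_nonneg _ _)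
      (sq_nonneg a))] at h2
    simpa using h2
  rw [le_div_iff₀ (by positivity)] at h3
  have h4 := variance_noise_le hε hσ hφ
  exact (le_abs_self a).trans (abs_le_of_sq_le_sq (by nlinarith) (by positivity))

end Noise

/-! ### Deterministic analysis of the constrained supremum -/

section Family

variable {E ι : Type*} [NormedAddCommGroup E] [InnerProductSpace ℝ E]

/-- The values of a convex penalty along a linear image of its domain: `u i` is the image point
of `i` and `a i` the penalty. -/
structure IsConvexFamily (u : ι → E) (a : ι → ℝ) : Prop where
  nonneg : ∀ i, 0 ≤ a i
  combo : ∀ i j (s t : ℝ), 0 ≤ s → 0 ≤ t → s + t = 1 →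
    ∃ k, u k = s • u i + t • u j ∧ a k ≤ s * a i + t * a j

/-- `i` minimizes `‖u i - e‖² + 2 a i`. -/
def IsProx (u : ι → E) (a : ι → ℝ) (e : E) (i : ι) : Prop :=
  ∀ j, ‖u i - e‖ ^ 2 + 2 * a i ≤ ‖u j - e‖ ^ 2 + 2 * a j

/-- The supremum of `⟪e, u i⟫ - a i` over the ball `‖u i‖ ≤ t`. -/
noncomputable def ballSup (u : ι → E) (a : ι → ℝ) (e : E) (t : ℝ) : ℝ :=
  ⨆ i : {i // ‖u i‖ ≤ t}, (inner ℝ e (u i) - a i)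

variable {u : ι → E} {a : ι → ℝ}

/-- First-order optimality, obtained by moving from `u i` a short way towards `u j`. -/
theorem IsProx.inner_le (h : IsConvexFamily u a) {e : E} {i : ι} (hi : IsProx u a e i) (j : ι) :
    inner ℝ (e - u i) (u j - u i) ≤ a j - a i := by
  set d := u j - u i with hd
  by_contra! hlt
  set c := inner ℝ (e - u i) d - (a j - a i) with hc
  have hc0 : 0 < c := by linarith
  set D := ‖d‖ ^ 2 with hD
  have hD0 : 0 ≤ D := sq_nonneg _
  -- This step length satisfies `s ≤ 1` and `s * D ≤ c`, so the change `s (s D - 2 c)` of the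
  -- objective is negative.
  set s := c / (c + D) with hs
  have hs0 : 0 < s := by positivity
  have hs1 : s ≤ 1 := by rw [hs, div_le_one (by positivity)]; linarith
  obtain ⟨k, hk, hak⟩ := h.combo i j (1 - s) s (by linarith) hs0.le (by ring)
  have h1 := hi k
  have h2 : u k - e = (u i - e) + s • d := by rw [hk, hd]; module
  rw [h2, norm_add_sq_real, norm_smul, inner_smul_right, mul_pow, Real.norm_eq_abs, sq_abs] at h1
  have h3 : inner ℝ (u i - e) d = - inner ℝ (e - u i) d := by
    rw [← inner_neg_left, neg_sub]
  rw [h3, ← hD] at h1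
  have h4 : 0 ≤ s * (s * D - 2 * c) := by
    rw [hc]; nlinarith
  have h5 : s * D - 2 * c < 0 := by
    have : s * D ≤ c := by
      rw [hs, div_mul_eq_mul_div, div_le_iff₀ (by positivity)]
      nlinarith
    linarith
  nlinarith

/-- Adding the two variational inequalities gives firm nonexpansiveness. With `e = e'` it shows that
the image point is unique. -/
theorem IsProx.norm_sub_le (h : IsConvexFamily u a) {e e' : E} {i j : ι} (hi : IsProx u a e i)
    (hj : IsProx u a e' j) : ‖u i - u j‖ ≤ ‖e - e'‖ := by
  have h1 := hi.inner_le h j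
  have h2 := hj.inner_le h i
  have h3 : ‖u i - u j‖ ^ 2 ≤ inner ℝ (e - e') (u i - u j) := by
    rw [← real_inner_self_eq_norm_sq]
    simp only [inner_sub_left, inner_sub_right] at *
    linarith
  have h4 := real_inner_le_norm (e - e') (u i - u j)
  by_contra! hlt
  nlinarith [norm_nonneg (e - e')]

theorem bddAbove_ball (h : IsConvexFamily u a) (e : E) (t : ℝ) :
    BddAbove (range fun i : {i // ‖u i‖ ≤ t} => inner ℝ e (u i) - a i) := by
  refine ⟨‖e‖ * t, ?_⟩
  rintro _ ⟨⟨i, hi⟩, rfl⟩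
  have := real_inner_le_norm e (u i)
  have := mul_le_mul_of_nonneg_left hi (norm_nonneg e)
  have := h.nonneg i
  simp only
  linarith

theorem le_ballSup (h : IsConvexFamily u a) (e : E) {t : ℝ} {i : ι} (hi : ‖u i‖ ≤ t) :
    inner ℝ e (u i) - a i ≤ ballSup u a e t :=
  le_ciSup (bddAbove_ball h e t) ⟨i, hi⟩

theorem ballSup_le {t : ℝ} (hne : ∃ i, ‖u i‖ ≤ t) (e : E) {b : ℝ}
    (hb : ∀ i, ‖u i‖ ≤ t → inner ℝ e (u i) - a i ≤ b) : ballSup u a e t ≤ b := by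
  obtain ⟨i, hi⟩ := hne
  have : Nonempty {i // ‖u i‖ ≤ t} := ⟨⟨i, hi⟩⟩
  exact ciSup_le fun i => hb i i.2

theorem ballSup_le_mul (h : IsConvexFamily u a) {t : ℝ} (hne : ∃ i, ‖u i‖ ≤ t) (e : E) :
    ballSup u a e t ≤ ‖e‖ * t := by
  refine ballSup_le hne e fun i hi => ?_
  have := real_inner_le_norm e (u i)
  have := mul_le_mul_of_nonneg_left hi (norm_nonneg e)
  have := h.nonneg i
  linarith

theorem ballSup_sub_le (h : IsConvexFamily u a) {t : ℝ} (hne : ∃ i, ‖u i‖ ≤ t) (e e' : E) :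
    ballSup u a e t ≤ ballSup u a e' t + t * ‖e - e'‖ := by
  refine ballSup_le hne e fun i hi => ?_
  have h1 := le_ballSup h e' hi
  have h2 := real_inner_le_norm (e - e') (u i)
  rw [inner_sub_left] at h2
  have := mul_le_mul_of_nonneg_left hi (norm_nonneg (e - e'))
  linarith

theorem lipschitzWith_ballSup (h : IsConvexFamily u a) {t : ℝ} (ht : 0 ≤ t)
    (hne : ∃ i, ‖u i‖ ≤ t) : LipschitzWith t.toNNReal fun e => ballSup u a e t := by
  refine LipschitzWith.of_le_add_mul _ fun e e' => ?_
  rw [Real.coe_toNNReal _ ht, dist_eq_norm]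
  exact ballSup_sub_le h hne e e'

theorem concaveOn_ballSup (h : IsConvexFamily u a) {c : ℝ} (hne : ∃ i, ‖u i‖ ≤ c) (e : E) :
    ConcaveOn ℝ (Ici c) (ballSup u a e) := by
  refine ⟨convex_Ici c, fun x hx y hy s t hs ht hst => ?_⟩
  have hex {x : ℝ} (hx : x ∈ Ici c) : ∃ i, ‖u i‖ ≤ x := hne.imp fun i hi => hi.trans hx
  refine le_of_forall_pos_le_add fun δ hδ => ?_
  obtain ⟨⟨i, hi⟩, hi'⟩ : ∃ i : {i // ‖u i‖ ≤ x}, ballSup u a e x - δ < inner ℝ e (u i) - a i := by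
    obtain ⟨i, hi⟩ := hex hx
    have : Nonempty {i // ‖u i‖ ≤ x} := ⟨⟨i, hi⟩⟩
    exact exists_lt_of_lt_ciSup (show ballSup u a e x - δ < ballSup u a e x by linarith)
  obtain ⟨⟨j, hj⟩, hj'⟩ : ∃ i : {i // ‖u i‖ ≤ y}, ballSup u a e y - δ < inner ℝ e (u i) - a i := by
    obtain ⟨i, hi⟩ := hex hy
    have : Nonempty {i // ‖u i‖ ≤ y} := ⟨⟨i, hi⟩⟩
    exact exists_lt_of_lt_ciSup (show ballSup u a e y - δ < ballSup u a e y by linarith)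
  obtain ⟨k, hk, hak⟩ := h.combo i j s t hs ht hst
  have hkn : ‖u k‖ ≤ s • x + t • y := by
    rw [hk]
    refine (norm_add_le _ _).trans ?_
    rw [norm_smul, norm_smul, Real.norm_of_nonneg hs, Real.norm_of_nonneg ht, smul_eq_mul,
      smul_eq_mul]
    gcongr
  have h1 := le_ballSup h e hkn
  rw [hk, inner_add_right, inner_smul_right, inner_smul_right] at h1
  simp only [smul_eq_mul] at h1 ⊢
  have h2 := mul_le_mul_of_nonneg_left hi'.le hs
  have h3 := mul_le_mul_of_nonneg_left hj'.le ht
  have h4 : s * δ + t * δ = δ := by rw [← add_mul, hst, one_mul]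
  linarith
/-- The penalized supremum has quadratic decay away from the norm of the prox point. -/
theorem IsProx.ballSup_sub_le (h : IsConvexFamily u a) {e : E} {i : ι} (hi : IsProx u a e i) {t : ℝ}
    (hne : ∃ i, ‖u i‖ ≤ t) :
    ballSup u a e t - t ^ 2 / 2
      ≤ ballSup u a e ‖u i‖ - ‖u i‖ ^ 2 / 2 - (t - ‖u i‖) ^ 2 / 2 := by
  have h0 := le_ballSup h e (le_refl ‖u i‖)
  have h1 : ballSup u a e t ≤ inner ℝ e (u i) - a i + ‖u i‖ * t - ‖u i‖ ^ 2 := by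
    refine ballSup_le hne e fun j hj => ?_
    have h2 := hi.inner_le h j
    have h3 := real_inner_le_norm (u i) (u j)
    have h4 := mul_le_mul_of_nonneg_left hj (norm_nonneg (u i))
    simp only [inner_sub_left, inner_sub_right, real_inner_self_eq_norm_sq] at h2
    linarith
  nlinarith

/-- Interpolates the quadratic decay by concavity, so that a deterministic `m` can replace the
random maximizer `‖u i‖`. -/
theorem IsProx.ballSup_sub_le_of_between (h : IsConvexFamily u a) {e : E} {i : ι}
    (hi : IsProx u a e i) {c m t : ℝ} (hc : ∃ i, ‖u i‖ ≤ c) (hci : c ≤ ‖u i‖) (hct : c ≤ t)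
    (hm : m ∈ uIcc ‖u i‖ t) :
    ballSup u a e t - t ^ 2 / 2 ≤ ballSup u a e m - m ^ 2 / 2 - (t - m) ^ 2 / 2 := by
  have h1 := hi.ballSup_sub_le h (t := t) (hc.imp fun i hi => hi.trans hct)
  obtain ⟨p, q, hp, hq, hpq, rfl⟩ := segment_eq_uIcc (𝕜 := ℝ) ‖u i‖ t ▸ hm
  have h2 := (concaveOn_ballSup h hc e).2 hci hct hp hq hpq
  simp only [smul_eq_mul] at *
  obtain rfl : q = 1 - p := by linarith
  have h3 := mul_le_mul_of_nonneg_left h1 hp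
  have h4 : 0 ≤ p * (1 - p) * (t - ‖u i‖) ^ 2 := by positivity
  nlinarith

/-- If the point of least norm is a prox point for some `e₀`, then `ballSup` is upper semicontinuous
at the left end of its domain. -/
theorem IsProx.ballSup_le_of_isLeast (h : IsConvexFamily u a) {e₀ : E} {i : ι}
    (hi : IsProx u a e₀ i) (hmin : ∀ j, ‖u i‖ ≤ ‖u j‖) {t : ℝ} (ht : ‖u i‖ ≤ t) (e : E) :
    ballSup u a e t ≤ ballSup u a e ‖u i‖ + ‖u i‖ * (t - ‖u i‖)
      + ‖e - e₀‖ * √(t ^ 2 - ‖u i‖ ^ 2) := by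
  refine ballSup_le ⟨i, ht⟩ e fun j hj => ?_
  have h0 := le_ballSup h e (le_refl ‖u i‖)
  have h2 := hi.inner_le h j
  have h3 := real_inner_le_norm (u i) (u j)
  have h4 := mul_le_mul_of_nonneg_left hj (norm_nonneg (u i))
  have h5 : ‖u i‖ ^ 2 ≤ inner ℝ (u i) (u j) := by
    -- A point of least norm is a prox point of `0` for the zero penalty; its variational inequality
    -- is the obtuse-angle property of projections.
    have hp : IsProx u (fun _ => (0 : ℝ)) 0 i := fun k => by
      simpa using pow_le_pow_left₀ (norm_nonneg _) (hmin k) 2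
    have := hp.inner_le ⟨fun _ => le_rfl, fun i j s t hs ht hst => by
      obtain ⟨k, hk, -⟩ := h.combo i j s t hs ht hst
      exact ⟨k, hk, by simp⟩⟩ j
    simp only [inner_sub_right, zero_sub, inner_neg_left, real_inner_self_eq_norm_sq] at this
    linarith
  have h6 : ‖u j - u i‖ ≤ √(t ^ 2 - ‖u i‖ ^ 2) := by
    refine Real.le_sqrt_of_sq_le ?_
    rw [norm_sub_sq_real, real_inner_comm]
    have := pow_le_pow_left₀ (norm_nonneg _) hj 2
    linarith
  have h7 := real_inner_le_norm (e - e₀) (u j - u i)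
  have h8 := mul_le_mul_of_nonneg_left h6 (norm_nonneg (e - e₀))
  simp only [inner_sub_left, inner_sub_right, real_inner_self_eq_norm_sq] at h2 h7
  linarith

end Family

/-! ### Existence of maximizers and medians; comparison of square roots -/

/-- Continuity at `c` is not available: `hleft` discards `[c, s]`, the quadratic bound discards
large arguments, and a compact interval remains. -/
theorem exists_isMaxOn_Ici {f : ℝ → ℝ} {c M : ℝ} (hf : ContinuousOn f (Ioi c))
    (hM : ∀ t, c ≤ t → f t ≤ M * t - t ^ 2 / 2)
    (hleft : ∃ s > c, ∃ t ≥ s, ∀ x ∈ Icc c s, f x ≤ f t) :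
    ∃ t, c ≤ t ∧ IsMaxOn f (Ici c) t := by
  obtain ⟨s, hs, t₁, ht₁, hx⟩ := hleft
  set R := max t₁ (2 * |M| + 2 + 2 * |f t₁|) with hR
  obtain ⟨t, ht, hmax⟩ := (isCompact_Icc (a := s) (b := R)).exists_isMaxOn
    ⟨t₁, ht₁, le_max_left _ _⟩ (hf.mono fun x hx => lt_of_lt_of_le hs hx.1)
  have h1 : f t₁ ≤ f t := hmax ⟨ht₁, le_max_left _ _⟩
  refine ⟨t, hs.le.trans ht.1, fun x hxc => ?_⟩
  rcases le_or_gt x s with hxs | hxs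
  · exact (hx x ⟨hxc, hxs⟩).trans h1
  rcases le_or_gt x R with hxR | hxR
  · exact hmax ⟨hxs.le, hxR⟩
  refine (hM x hxc).trans (le_trans ?_ h1)
  have h2 : 2 * |M| + 2 + 2 * |f t₁| ≤ x := (le_max_right _ _).trans hxR.le
  have h3 := le_abs_self M
  have h4 := neg_abs_le (f t₁)
  have h5 := abs_nonneg (f t₁)
  have h6 := abs_nonneg M
  nlinarith

/-- The least 1/2-quantile works: right continuity of the cdf gives one inequality and its left
limit the other. -/
theorem exists_isMedian {Ω : Type*} [MeasurableSpace Ω] (P : Measure Ω) [IsProbabilityMeasure P]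
    {Y : Ω → ℝ} (hY : AEMeasurable Y P) : ∃ m, IsMedian P Y m := by
  have := Measure.isProbabilityMeasure_map hY
  set ν := P.map Y with hν
  set S := {x | 1 / 2 ≤ cdf ν x} with hS
  have hne : S.Nonempty :=
    ((tendsto_cdf_atTop ν).eventually (eventually_ge_nhds (by norm_num : (1 / 2 : ℝ) < 1))).exists
  have hbdd : BddBelow S := by
    obtain ⟨b, hb⟩ := ((tendsto_cdf_atBot ν).eventually
      (eventually_lt_nhds (by norm_num : (0 : ℝ) < 1 / 2))).exists
    refine ⟨b, fun x hx => ?_⟩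
    by_contra! hlt
    exact absurd (lt_of_le_of_lt (hx.trans (monotone_cdf ν hlt.le)) hb) (lt_irrefl _)
  set m := sInf S with hm
  have hright : 1 / 2 ≤ cdf ν m := by
    have h1 : Tendsto (cdf ν) (𝓝[>] m) (𝓝 (cdf ν m)) :=
      ((cdf ν).right_continuous m).tendsto.mono_left (nhdsWithin_mono _ Ioi_subset_Ici_self)
    refine ge_of_tendsto h1 (eventually_nhdsWithin_of_forall fun x hx => ?_)
    obtain ⟨y, hy, hyx⟩ := exists_lt_of_csInf_lt hne hx
    exact hy.trans (monotone_cdf ν hyx.le)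
  have hlt : ∀ x < m, cdf ν x < 1 / 2 := fun x hx => by
    by_contra! hle
    exact absurd (csInf_le hbdd hle) (not_le.2 hx)
  have hleft : ν (Iio m) ≤ 1 / 2 := by
    rw [← measure_cdf ν, StieltjesFunction.measure_Iio _ (tendsto_cdf_atBot ν), sub_zero]
    have h2 : Function.leftLim (cdf ν) m ≤ 1 / 2 :=
      le_of_tendsto ((monotone_cdf ν).tendsto_leftLim m)
        (eventually_nhdsWithin_of_forall fun x hx => (hlt x hx).le)
    refine (ENNReal.ofReal_le_ofReal h2).trans_eq ?_
    rw [ENNReal.ofReal_div_of_pos two_pos]; simp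
  refine ⟨m, ?_, ?_⟩
  · have h3 : ν (Iic m) = P {ω | Y ω ≤ m} := Measure.map_apply_of_aemeasurable hY measurableSet_Iic
    rw [← h3, ← ofReal_cdf]
    refine le_trans (by rw [ENNReal.ofReal_div_of_pos two_pos]; simp)
      (ENNReal.ofReal_le_ofReal hright)
  · have h4 : ν (Ici m) = P {ω | m ≤ Y ω} := Measure.map_apply_of_aemeasurable hY measurableSet_Ici
    rw [← h4, ← compl_Iio, prob_compl_eq_one_sub measurableSet_Iio]
    calc (1 / 2 : ℝ≥0∞) = 1 - 1 / 2 := by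
          rw [one_div, ENNReal.one_sub_inv_two]
      _ ≤ _ := tsub_le_tsub_left hleft 1

theorem abs_sqrt_sub_sqrt_le {x y b : ℝ} (hx : 0 ≤ x) (hy : 0 ≤ y) (hb : 0 ≤ b)
    (h : (x - y) ^ 2 ≤ b * (x + y)) : |√x - √y| ≤ √b := by
  refine Real.abs_le_sqrt ?_
  have h1 := Real.sq_sqrt hx
  have h2 := Real.sq_sqrt hy
  have h3 := Real.sqrt_nonneg x
  have h4 := Real.sqrt_nonneg y
  rcases (add_nonneg h3 h4).eq_or_lt with h0 | h0
  · rw [show √x = 0 by linarith, show √y = 0 by linarith]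
    simpa using hb
  have h5 : (√x - √y) ^ 2 * (√x + √y) ^ 2 ≤ b * (√x + √y) ^ 2 := by
    calc _ = (x - y) ^ 2 := by
          rw [← mul_pow]; congr 1; linear_combination h1 - h2
      _ ≤ b * (x + y) := h
      _ ≤ _ := by
        gcongr
        nlinarith [mul_nonneg h3 h4]
  exact le_of_mul_le_mul_right h5 (by positivity)

/-! ### Concavity, uniqueness and existence of the maximizer of the mean criterion -/

section Mean

variable {n : ℕ} {Ω ι : Type*} [MeasurableSpace Ω] {P : Measure Ω}
  {ε : Ω → EuclideanSpace ℝ (Fin n)} {u : ι → EuclideanSpace ℝ (Fin n)} {a : ι → ℝ} {c : ℝ}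

/-- The real-valued criterion `E[ballSup t] - t² / 2`. -/
noncomputable def meanCriterion (P : Measure Ω) (ε : Ω → EuclideanSpace ℝ (Fin n))
    (u : ι → EuclideanSpace ℝ (Fin n)) (a : ι → ℝ) (t : ℝ) : ℝ :=
  ∫ ω, ballSup u a (ε ω) t ∂P - t ^ 2 / 2

variable [IsProbabilityMeasure P] (hε : MemLp ε 2 P) (h : IsConvexFamily u a)
  (hc : ∃ i, ‖u i‖ ≤ c) (hc0 : 0 ≤ c)
include hε h hc hc0

theorem integrable_ballSup {t : ℝ} (ht : c ≤ t) :
    Integrable (fun ω => ballSup u a (ε ω) t) P :=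
  (memLp_two_of_lipschitz hε (lipschitzWith_ballSup h (hc0.trans ht)
    (hc.imp fun _ hi => hi.trans ht))).integrable one_le_two

theorem concaveOn_integral_ballSup :
    ConcaveOn ℝ (Ici c) fun t => ∫ ω, ballSup u a (ε ω) t ∂P := by
  refine ⟨convex_Ici c, fun x hx y hy p q hp hq hpq => ?_⟩
  have hix := integrable_ballSup hε h hc hc0 hx
  have hiy := integrable_ballSup hε h hc hc0 hy
  have hixy := integrable_ballSup hε h hc hc0 (convex_Ici c hx hy hp hq hpq)
  simp only [smul_eq_mul] at hixy ⊢
  rw [← integral_const_mul, ← integral_const_mul,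
    ← integral_add (hix.const_mul p) (hiy.const_mul q)]
  exact integral_mono ((hix.const_mul p).add (hiy.const_mul q)) hixy
    fun ω => (concaveOn_ballSup h hc (ε ω)).2 hx hy hp hq hpq

omit hε h hc hc0 [IsProbabilityMeasure P] in
theorem concaveOn_sub_sq {g : ℝ → ℝ} (hg : ConcaveOn ℝ (Ici c) g) :
    ConcaveOn ℝ (Ici c) fun t => g t - t ^ 2 / 2 := by
  refine ⟨convex_Ici c, fun x hx y hy p q hp hq hpq => ?_⟩
  have h1 := hg.2 hx hy hp hq hpq
  simp only [smul_eq_mul] at *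
  obtain rfl : q = 1 - p := by linarith
  nlinarith [mul_nonneg (mul_nonneg hp hq) (sq_nonneg (x - y))]

theorem concaveOn_meanCriterion : ConcaveOn ℝ (Ici c) (meanCriterion P ε u a) :=
  concaveOn_sub_sq (concaveOn_integral_ballSup hε h hc hc0)

/-- At the midpoint, `-t²/2` gains `(s - t)²/8` over the concave part. -/
theorem eq_of_isMaxOn_meanCriterion {s t : ℝ} (hs : c ≤ s) (ht : c ≤ t)
    (hsm : IsMaxOn (meanCriterion P ε u a) (Ici c) s)
    (htm : IsMaxOn (meanCriterion P ε u a) (Ici c) t) : s = t := by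
  have h1 := (concaveOn_integral_ballSup hε h hc hc0).2 (mem_Ici.2 hs) (mem_Ici.2 ht)
    (by norm_num : (0 : ℝ) ≤ 1 / 2) (by norm_num : (0 : ℝ) ≤ 1 / 2) (by norm_num)
  have hmid : c ≤ 1 / 2 * s + 1 / 2 * t := by linarith
  have h2 := hsm (mem_Ici.2 hmid)
  have h3 := htm (mem_Ici.2 hmid)
  simp only [smul_eq_mul, meanCriterion, mem_ofPred_eq] at h1 h2 h3
  nlinarith [sq_nonneg (s - t)]

theorem meanCriterion_le {t : ℝ} (ht : c ≤ t) :
    meanCriterion P ε u a t ≤ (∫ ω, ‖ε ω‖ ∂P) * t - t ^ 2 / 2 := by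
  unfold meanCriterion
  rw [← integral_mul_const]
  gcongr
  · exact integrable_ballSup hε h hc hc0 ht
  · exact (hε.integrable one_le_two).norm.mul_const t
  · exact fun ω => ballSup_le_mul h (hc.imp fun _ hi => hi.trans ht) _

/-- If no prox point has the least norm `c`, the mean criterion increases somewhere
on `(c, ∞)`. -/
theorem exists_meanCriterion_lt (hprox : ∀ e, ∃ i, IsProx u a e i ∧ c < ‖u i‖) :
    ∃ s t, c < s ∧ s < t ∧ meanCriterion P ε u a s < meanCriterion P ε u a t := by
  by_contra! hcon
  set s : ℕ → ℝ := fun j => c + (1 / 2) ^ j with hs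
  have hsc (j) : c < s j := by simp [hs]
  have hlt (j) : s (j + 1) < s j := by
    have : (0 : ℝ) < (1 / 2) ^ j := by positivity
    simp only [hs, pow_succ]; linarith
  have hslim : Tendsto s atTop (𝓝 c) := by
    simpa [hs] using (tendsto_pow_atTop_nhds_zero_of_lt_one (r := (1 / 2 : ℝ))
      (by norm_num) (by norm_num)).const_add c
  set F : Ω → ℝ → ℝ := fun ω t => ballSup u a (ε ω) t - t ^ 2 / 2 with hF
  have hFc (ω) : ConcaveOn ℝ (Ici c) (F ω) := concaveOn_sub_sq (concaveOn_ballSup h hc (ε ω))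
  have hFi (j) : Integrable (fun ω => F ω (s j)) P :=
    (integrable_ballSup hε h hc hc0 (hsc j).le).sub (integrable_const _)
  -- Slopes over adjacent dyadic intervals shrinking to `c`: by concavity they increase with `j`,
  -- and by `hcon` their means are nonpositive.
  set D : ℕ → Ω → ℝ := fun j ω => (F ω (s j) - F ω (s (j + 1))) / (s j - s (j + 1)) with hD
  have hDi (j) : Integrable (D j) P := ((hFi j).sub (hFi (j + 1))).div_const _
  have hDint (j) : ∫ ω, D j ω ∂P ≤ 0 := by
    simp only [hD]
    rw [integral_div, integral_sub (hFi j) (hFi (j + 1))]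
    have hm (j) : ∫ ω, F ω (s j) ∂P = meanCriterion P ε u a (s j) := by
      simp only [hF, meanCriterion]
      rw [integral_sub (integrable_ballSup hε h hc hc0 (hsc j).le) (integrable_const _)]
      simp
    rw [hm, hm]
    exact div_nonpos_of_nonpos_of_nonneg
      (by linarith [hcon _ _ (hsc (j + 1)) (hlt j)]) (by linarith [hlt j])
  -- Truncation at `1` traps the increasing sequence between `W 0` and `1`, so dominated convergence
  -- applies.
  set W : ℕ → Ω → ℝ := fun j ω => min (D j ω) 1 with hW
  have hWi (j) : Integrable (W j) P := (hDi j).inf (integrable_const 1)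
  have hmono (ω) : Monotone fun j => W j ω := monotone_nat_of_le_succ fun j =>
    min_le_min_right 1 ((hFc ω).slope_anti_adjacent (hsc (j + 2)).le (hsc j).le
      (hlt (j + 1)) (hlt j))
  have hbdd (ω) : BddAbove (range fun j => W j ω) :=
    ⟨1, by rintro _ ⟨j, rfl⟩; exact min_le_right _ _⟩
  have hbound (j ω) : |W j ω| ≤ |W 0 ω| + 1 := by
    have h1 : W 0 ω ≤ W j ω := hmono ω (Nat.zero_le j)
    have h2 : W j ω ≤ 1 := min_le_right _ _
    rw [abs_le]
    constructor <;> linarith [neg_abs_le (W 0 ω), abs_nonneg (W 0 ω)]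
  have hpt (ω) : Tendsto (fun j => W j ω) atTop (𝓝 (⨆ j, W j ω)) :=
    tendsto_atTop_ciSup (hmono ω) (hbdd ω)
  have hBi : Integrable (fun ω => |W 0 ω| + 1) P := (hWi 0).abs.add (integrable_const 1)
  have hlim := tendsto_integral_of_dominated_convergence _ (fun j => (hWi j).1) hBi
    (fun j => ae_of_all P fun ω => hbound j ω) (ae_of_all P hpt)
  have hle : ∫ ω, (⨆ j, W j ω) ∂P ≤ 0 := le_of_tendsto' hlim fun j =>
    (integral_mono (hWi j) (hDi j) fun ω => min_le_left _ _).trans (hDint j)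
  have hpos (ω) : 0 < ⨆ j, W j ω := by
    obtain ⟨i, hi, hci⟩ := hprox (ε ω)
    -- Once `s j ≤ ‖u i‖`, the interval lies left of the pathwise maximizer, where the slope is
    -- strictly positive.
    obtain ⟨j, hj⟩ := (hslim.eventually (eventually_le_nhds hci)).exists
    refine lt_of_lt_of_le (lt_min ?_ one_pos) (le_ciSup (hbdd ω) j)
    have h1 := hi.ballSup_sub_le_of_between h hc hci.le (hsc (j + 1)).le (m := s j)
      (by rw [uIcc_of_ge ((hlt j).le.trans hj)]; exact ⟨(hlt j).le, hj⟩)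
    have h2 : 0 < s j - s (j + 1) := by linarith [hlt j]
    refine div_pos ?_ h2
    simp only [hF]
    nlinarith
  have hsi : Integrable (fun ω => ⨆ j, W j ω) P := by
    refine hBi.mono' (aestronglyMeasurable_of_tendsto_ae atTop (fun j => (hWi j).1)
      (ae_of_all P hpt)) (ae_of_all P fun ω => ?_)
    exact le_of_tendsto' (hpt ω).abs fun j => hbound j ω
  have hcontra : 0 < ∫ ω, (⨆ j, W j ω) ∂P := by
    rw [integral_pos_iff_support_of_nonneg (fun ω => (hpos ω).le) hsi]
    have : Function.support (fun ω => ⨆ j, W j ω) = univ :=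
      eq_univ_of_forall fun ω => (hpos ω).ne'
    simp [this]
  linarith

/-- The mean criterion is upper semicontinuous at `c` if some prox point has the least norm `c`. -/
theorem exists_forall_Icc_meanCriterion_le {e₀ : EuclideanSpace ℝ (Fin n)} {i : ι}
    (hi : IsProx u a e₀ i) (hic : ‖u i‖ = c) (hmin : ∀ j, c ≤ ‖u j‖) {t₁ : ℝ} (ht₁ : c ≤ t₁)
    (hlt : meanCriterion P ε u a c < meanCriterion P ε u a t₁) :
    ∃ s > c, ∃ t ≥ s, ∀ x ∈ Icc c s, meanCriterion P ε u a x ≤ meanCriterion P ε u a t := by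
  set B := ∫ ω, ‖ε ω - e₀‖ ∂P with hB
  set η : ℝ → ℝ := fun x => meanCriterion P ε u a c + c * (x - c) + B * √(x ^ 2 - c ^ 2)
    with hη
  have hBi : Integrable (fun ω => ‖ε ω - e₀‖) P :=
    ((hε.integrable one_le_two).sub (integrable_const e₀)).norm
  have hle (x) (hx : c ≤ x) : meanCriterion P ε u a x ≤ η x := by
    have h1 : ∫ ω, ballSup u a (ε ω) x ∂P ≤ ∫ ω, (ballSup u a (ε ω) c + c * (x - c)
        + ‖ε ω - e₀‖ * √(x ^ 2 - c ^ 2)) ∂P := by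
      refine integral_mono (integrable_ballSup hε h hc hc0 hx)
        (((integrable_ballSup hε h hc hc0 le_rfl).add (integrable_const _)).add
          (hBi.mul_const _)) fun ω => ?_
      have := hi.ballSup_le_of_isLeast h (fun j => hic.trans_le (hmin j)) (hic.trans_le hx) (ε ω)
      rwa [hic] at this
    have hadd : Integrable (fun ω => ballSup u a (ε ω) c + c * (x - c)) P :=
      (integrable_ballSup hε h hc hc0 le_rfl).add (integrable_const _)
    rw [integral_add hadd (hBi.mul_const _), integral_add (integrable_ballSup hε h hc hc0 le_rfl) (integrable_const _),
      integral_const, integral_mul_const] at h1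
    simp only [probReal_univ, smul_eq_mul, one_mul] at h1
    simp only [hη, meanCriterion]
    nlinarith
  have hηc : ContinuousAt η c := Continuous.continuousAt (by fun_prop)
  have hη0 : η c = meanCriterion P ε u a c := by simp [hη]
  have hev : ∀ᶠ x in 𝓝 c, η x < meanCriterion P ε u a t₁ :=
    hηc.eventually (eventually_lt_nhds (hη0 ▸ hlt))
  obtain ⟨δ, hδ, hball⟩ := Metric.eventually_nhds_iff.1 hev
  have hkey (x) (hx : x ∈ Icc c (c + δ / 2)) : η x < meanCriterion P ε u a t₁ :=
    hball (by rw [Real.dist_eq, abs_of_nonneg (by linarith [hx.1])]; linarith [hx.2])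
  refine ⟨c + δ / 2, by linarith, t₁, ?_, fun x hx => (hle x hx.1).trans (hkey x hx).le⟩
  by_contra! hcon
  exact absurd ((hle t₁ ht₁).trans_lt (hkey t₁ ⟨ht₁, hcon.le⟩)) (lt_irrefl _)

theorem exists_isMaxOn_meanCriterion (hmin : ∀ j, c ≤ ‖u j‖) (hprox : ∀ e, ∃ i, IsProx u a e i) :
    ∃ t, c ≤ t ∧ IsMaxOn (meanCriterion P ε u a) (Ici c) t := by
  by_cases hmax : IsMaxOn (meanCriterion P ε u a) (Ici c) c
  · exact ⟨c, le_rfl, hmax⟩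
  have hconc := concaveOn_meanCriterion hε h hc hc0
  refine exists_isMaxOn_Ici (interior_Ici (a := c) ▸ hconc.continuousOn_interior)
    (fun t ht => meanCriterion_le hε h hc hc0 ht) ?_
  by_cases hex : ∃ e₀ i, IsProx u a e₀ i ∧ ‖u i‖ = c
  · obtain ⟨e₀, i, hi, hic⟩ := hex
    simp only [isMaxOn_iff, not_forall, not_le] at hmax
    obtain ⟨t₁, ht₁, hlt⟩ := hmax
    exact exists_forall_Icc_meanCriterion_le hε h hc hc0 hi hic hmin ht₁ hlt
  · push Not at hex
    obtain ⟨s, t, hs, hst, hlt⟩ := exists_meanCriterion_lt hε h hc hc0 fun e => by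
      obtain ⟨i, hi⟩ := hprox e
      exact ⟨i, hi, lt_of_le_of_ne (hmin i) (hex e i hi).symm⟩
    -- For a concave function, an increase from `s` to `t` forces all values on `[c, s]` below the
    -- value at `t`.
    refine ⟨s, hs, t, hst.le, fun x hx => ?_⟩
    by_contra! hcon
    have := hconc.min_le_of_mem_Icc hx.1 (hs.trans hst).le ⟨hx.2, hst.le⟩
    rw [min_eq_right hcon.le] at this
    linarith

end Mean

/-! ### Concentration of the prediction error and its median -/

section Deviation

variable {n : ℕ} {Ω ι : Type*} [MeasurableSpace Ω] {P : Measure Ω} [IsProbabilityMeasure P]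
  {ε : Ω → EuclideanSpace ℝ (Fin n)} {u : ι → EuclideanSpace ℝ (Fin n)} {a : ι → ℝ} {c σ : ℝ}
  (hσ : 0 < σ) (hε : HasLaw ε (multivariateGaussian 0 (σ ^ 2 • (1 : Matrix (Fin n) (Fin n) ℝ))) P)
  (h : IsConvexFamily u a)
include hσ hε h

theorem sq_sub_le_of_isMedian (hc : ∃ i, ‖u i‖ ≤ c) (hmin : ∀ j, c ≤ ‖u j‖) (hc0 : 0 ≤ c)
    {i : Ω → ι} (hi : ∀ ω, IsProx u a (ε ω) (i ω)) {t m : ℝ} (ht : c ≤ t)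
    (htm : IsMaxOn (meanCriterion P ε u a) (Ici c) t)
    (hm : IsMedian P (fun ω => ‖u (i ω)‖) m) :
    (t - m) ^ 2 ≤ Real.pi * σ * (t + m) := by
  have hmc : c ≤ m := by
    have h1 : P {ω | ‖u (i ω)‖ ≤ m} ≠ 0 := fun h0 => by simpa [h0] using hm.1
    obtain ⟨ω, hω⟩ := nonempty_of_measure_ne_zero h1
    exact (hmin _).trans hω
  have hex {x} (hx : c ≤ x) : ∃ i, ‖u i‖ ≤ x := hc.imp fun i hi => hi.trans hx
  have hLm := lipschitzWith_ballSup h (hc0.trans hmc) (hex hmc)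
  have hLt := lipschitzWith_ballSup h (hc0.trans ht) (hex ht)
  have hL := hLm.sub hLt
  -- The half of the median property to use depends on which side of `t` the median lies.
  obtain ⟨A, hA, hbetween⟩ : ∃ A : Set Ω, 1 / 2 ≤ P A ∧ ∀ ω ∈ A, m ∈ uIcc ‖u (i ω)‖ t := by
    rcases le_total m t with hmt | hmt
    · refine ⟨_, hm.1, fun ω hω => ?_⟩
      rw [uIcc_of_le (le_trans (show ‖u (i ω)‖ ≤ m from hω) hmt)]
      exact ⟨hω, hmt⟩
    · refine ⟨_, hm.2, fun ω hω => ?_⟩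
      rw [uIcc_of_ge (le_trans hmt (show m ≤ ‖u (i ω)‖ from hω))]
      exact ⟨hmt, hω⟩
  have hint {x} (hx : c ≤ x) := integrable_ballSup (memLp_noise hε) h hc hc0 hx
  have hdev := le_of_half_le_measure_deviation hε hσ hL (a := (t - m) ^ 2 / 2) <|
    hA.trans <| measure_mono fun ω hω => by
      have h1 := (hi ω).ballSup_sub_le_of_between h hc (hmin _) ht (hbetween ω hω)
      have h2 := htm (mem_Ici.2 hmc)
      simp only [mem_ofPred_eq, meanCriterion] at h2 ⊢
      rw [integral_sub (hint hmc) (hint ht)]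
      linarith
  rw [NNReal.coe_add, Real.coe_toNNReal _ (hc0.trans hmc), Real.coe_toNNReal _ (hc0.trans ht)]
    at hdev
  linarith

omit [MeasurableSpace Ω] [IsProbabilityMeasure P] hσ hε in
-- Any selection of prox points has the same image as `i`, so the norm is a Lipschitz function of
-- the noise even if `i` is not measurable.
theorem exists_lipschitzWith_norm_prox (hprox : ∀ e, ∃ i, IsProx u a e i) {i : Ω → ι}
    (hi : ∀ ω, IsProx u a (ε ω) (i ω)) :
    ∃ φ : EuclideanSpace ℝ (Fin n) → ℝ, LipschitzWith 1 φ ∧ ∀ ω, ‖u (i ω)‖ = φ (ε ω) := by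
  choose sel hsel using hprox
  refine ⟨fun e => ‖u (sel e)‖, LipschitzWith.of_dist_le_mul fun e e' => ?_, fun ω => ?_⟩
  · rw [Real.dist_eq, NNReal.coe_one, one_mul, dist_eq_norm]
    exact (abs_norm_sub_norm_le _ _).trans ((hsel e).norm_sub_le h (hsel e'))
  · have := (hi ω).norm_sub_le h (hsel (ε ω))
    rw [sub_self, norm_zero, norm_le_zero_iff, sub_eq_zero] at this
    rw [this]

omit h in
theorem abs_median_sub_integral_le {φ : EuclideanSpace ℝ (Fin n) → ℝ} (hφ : LipschitzWith 1 φ)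
    {m : ℝ} (hm : IsMedian P (fun ω => φ (ε ω)) m) :
    |m - ∫ ω, φ (ε ω) ∂P| ≤ Real.pi / 2 * σ := by
  have h1 := le_of_half_le_measure_deviation hε hσ hφ (a := m - ∫ ω, φ (ε ω) ∂P) <|
    hm.2.trans <| measure_mono fun ω (hω : m ≤ φ (ε ω)) => sub_le_sub_right hω _
  have h2 := le_of_half_le_measure_deviation hε hσ hφ.neg (a := ∫ ω, φ (ε ω) ∂P - m) <|
    hm.1.trans <| measure_mono fun ω (hω : φ (ε ω) ≤ m) => by
      simp only [mem_ofPred_eq, Pi.neg_apply, integral_neg]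
      linarith
  rw [NNReal.coe_one, mul_one] at h1 h2
  exact abs_le.2 ⟨by linarith, h1⟩

end Deviation

/-! ### From the extended-real formulation to the real family -/

section Bridge

variable {n p : ℕ} {Ω : Type*} [MeasurableSpace Ω] {P : Measure Ω}
  {X : Matrix (Fin n) (Fin p) ℝ} {h : EuclideanSpace ℝ (Fin p) → ℝ≥0∞}
  {βs : EuclideanSpace ℝ (Fin p)}

theorem extExpectation_coe {Y : Ω → ℝ} (hY : Integrable Y P) :
    extExpectation P (fun ω => (Y ω : EReal)) = ((∫ ω, Y ω ∂P : ℝ) : EReal) := by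
  have h1 : ∫⁻ ω, ENNReal.ofReal (Y ω) ∂P ≠ ⊤ := hY.lintegral_lt_top.ne
  have h2 : ∫⁻ ω, ENNReal.ofReal (-Y ω) ∂P ≠ ⊤ := hY.neg.lintegral_lt_top.ne
  rw [integral_eq_lintegral_pos_part_sub_lintegral_neg_part hY, EReal.coe_sub,
    EReal.coe_ennreal_toReal h1, EReal.coe_ennreal_toReal h2]
  simp only [extExpectation, ← EReal.coe_neg, EReal.real_coe_toENNReal]

theorem extExpectation_bot [IsProbabilityMeasure P] :
    extExpectation P (fun _ => (⊥ : EReal)) = ⊥ := by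
  simp [extExpectation]

/-- The shifted image points `X(β - β*)`, for `β` in the domain of `h`. -/
noncomputable def domImage (X : Matrix (Fin n) (Fin p) ℝ) (h : EuclideanSpace ℝ (Fin p) → ℝ≥0∞)
    (βs : EuclideanSpace ℝ (Fin p)) (β : dom h) : EuclideanSpace ℝ (Fin n) :=
  X.toEuclideanLin (β.1 - βs)

/-- The real values of `h` on its domain. -/
noncomputable def domPenalty (h : EuclideanSpace ℝ (Fin p) → ℝ≥0∞) (β : dom h) : ℝ :=
  (h β.1).toReal

theorem isConvexFamily_domImage (hh : ConvexOn ℝ≥0 univ h) :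
    IsConvexFamily (domImage X h βs) (domPenalty h) where
  nonneg _ := ENNReal.toReal_nonneg
  combo := by
    rintro ⟨x, hx⟩ ⟨y, hy⟩ s t hs ht hst
    lift s to ℝ≥0 using hs
    lift t to ℝ≥0 using ht
    have h1 := hh.2 (mem_univ x) (mem_univ y) (zero_le (a := s)) (zero_le (a := t))
      (by exact_mod_cast hst)
    have hfin : s • h x + t • h y ≠ ⊤ :=
      ENNReal.add_ne_top.2 ⟨ENNReal.mul_ne_top ENNReal.coe_ne_top (ne_of_lt hx),
        ENNReal.mul_ne_top ENNReal.coe_ne_top (ne_of_lt hy)⟩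
    refine ⟨⟨s • x + t • y, lt_of_le_of_lt h1 hfin.lt_top⟩, ?_, ?_⟩
    · simp only [domImage]
      rw [← map_smul, ← map_smul, ← map_add]
      congr 1
      have hb : βs = (s : ℝ) • βs + (t : ℝ) • βs := by rw [← add_smul, hst, one_smul]
      conv_lhs => rw [hb]
      simp only [NNReal.smul_def]
      module
    · have h2 := ENNReal.toReal_mono hfin h1
      rw [ENNReal.toReal_add (ENNReal.add_ne_top.1 hfin).1 (ENNReal.add_ne_top.1 hfin).2] at h2
      simpa [domPenalty, ENNReal.smul_def] using h2

theorem IsSolution.mem_dom (hne : (dom h).Nonempty) {y : EuclideanSpace ℝ (Fin n)}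
    {b : EuclideanSpace ℝ (Fin p)} (hb : IsSolution X h y b) : b ∈ dom h := by
  obtain ⟨β, hβ⟩ := hne
  have h1 : objective X h y b < ⊤ := (hb β).trans_lt <|
    ENNReal.add_lt_top.2 ⟨ENNReal.ofReal_lt_top, ENNReal.mul_lt_top (by simp) hβ⟩
  have h2 := (ENNReal.add_lt_top.1 h1).2
  by_contra hcon
  have : h b = ⊤ := by simpa [dom] using hcon
  simp [this] at h2

theorem toReal_objective (e : EuclideanSpace ℝ (Fin n)) (β : dom h) :
    (objective X h (X.toEuclideanLin βs + e) β.1).toReal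
      = ‖domImage X h βs β - e‖ ^ 2 + 2 * domPenalty h β := by
  have hβ : h β.1 ≠ ⊤ := ne_of_lt β.2
  rw [objective, ENNReal.toReal_add ENNReal.ofReal_ne_top (ENNReal.mul_ne_top (by simp) hβ),
    ENNReal.toReal_ofReal (sq_nonneg _), ENNReal.toReal_mul, domImage, map_sub, domPenalty,
    sub_sub]
  simp

theorem IsSolution.isProx {e : EuclideanSpace ℝ (Fin n)} {b : EuclideanSpace ℝ (Fin p)}
    (hb : IsSolution X h (X.toEuclideanLin βs + e) b) (hbd : b ∈ dom h) :
    IsProx (domImage X h βs) (domPenalty h) e ⟨b, hbd⟩ := fun β => by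
  rw [← toReal_objective, ← toReal_objective]
  refine ENNReal.toReal_mono ?_ (hb β.1)
  exact ENNReal.add_ne_top.2 ⟨ENNReal.ofReal_ne_top, ENNReal.mul_ne_top (by simp) (ne_of_lt β.2)⟩

theorem F_eq_coe (hh : ConvexOn ℝ≥0 univ h) (e : EuclideanSpace ℝ (Fin n)) {t : ℝ}
    (hne : ∃ β, ‖domImage X h βs β‖ ≤ t) :
    F X h βs e t
      = ((ballSup (domImage X h βs) (domPenalty h) e t - t ^ 2 / 2 : ℝ) : EReal) := by
  have hfam : IsConvexFamily (domImage X h βs) (domPenalty h) := isConvexFamily_domImage hh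
  rw [F, EReal.coe_sub]
  congr 1
  have hval (β : dom h) : ((inner ℝ e (X.toEuclideanLin (β.1 - βs)) : ℝ) : EReal) - (h β.1 : EReal)
      = ((inner ℝ e (domImage X h βs β) - domPenalty h β : ℝ) : EReal) := by
    rw [EReal.coe_sub, domPenalty, EReal.coe_ennreal_toReal (ne_of_lt β.2), domImage]
  refine le_antisymm (iSup₂_le fun β hβ => ?_) (le_of_forall_lt fun z hz => ?_)
  · by_cases hd : h β = ⊤
    · simp [hd]
    · rw [hval ⟨β, Ne.lt_top hd⟩]
      exact EReal.coe_le_coe_iff.2 (le_ballSup hfam e hβ)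
  · obtain ⟨x, hzx, hx⟩ := EReal.lt_iff_exists_real_btwn.1 hz
    obtain ⟨β₀, hβ₀⟩ := hne
    have : Nonempty {i // ‖domImage X h βs i‖ ≤ t} := ⟨⟨β₀, hβ₀⟩⟩
    obtain ⟨⟨β, hβ⟩, hlt⟩ := exists_lt_of_lt_ciSup (EReal.coe_lt_coe_iff.1 hx)
    refine hzx.trans (lt_of_lt_of_le (EReal.coe_lt_coe_iff.2 hlt) ?_)
    rw [← hval β]
    exact le_iSup₂_of_le β.1 hβ le_rfl

theorem F_eq_bot (e : EuclideanSpace ℝ (Fin n)) {t : ℝ}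
    (hlt : ∀ β, t < ‖domImage X h βs β‖) : F X h βs e t = ⊥ := by
  have h1 : (⨆ β ∈ {β : EuclideanSpace ℝ (Fin p) | predError X βs β ≤ t},
      ((inner ℝ e (X.toEuclideanLin (β - βs)) : ℝ) : EReal) - (h β : EReal)) = ⊥ := by
    refine le_bot_iff.1 (iSup₂_le fun β hβ => ?_)
    have hd : h β = ⊤ := by
      by_contra hd
      exact absurd (hlt ⟨β, Ne.lt_top hd⟩) (not_lt.2 hβ)
    simp [hd]
  rw [F, h1, EReal.bot_sub]

variable [IsProbabilityMeasure P] {ε : Ω → EuclideanSpace ℝ (Fin n)} {c : ℝ}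

/-- Left of `c` the criterion is `⊥`, and from `c` on it is real. Attainment of `c` makes the value
there finite, which rules out maximizers below `c`. -/
theorem isMaximizer_f_iff (hh : ConvexOn ℝ≥0 univ h) (hε : MemLp ε 2 P)
    (hc : ∃ β, ‖domImage X h βs β‖ = c) (hmin : ∀ β, c ≤ ‖domImage X h βs β‖) (t : ℝ) :
    IsMaximizer (f P ε X h βs) t ↔
      c ≤ t ∧ IsMaxOn (meanCriterion P ε (domImage X h βs) (domPenalty h)) (Ici c) t := by
  have hfam : IsConvexFamily (domImage X h βs) (domPenalty h) := isConvexFamily_domImage hh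
  have hc' : ∃ β, ‖domImage X h βs β‖ ≤ c := hc.imp fun _ => le_of_eq
  have hc0 : 0 ≤ c := by obtain ⟨β, rfl⟩ := hc; exact norm_nonneg _
  have hge {x : ℝ} (hx : c ≤ x) : f P ε X h βs x
      = (meanCriterion P ε (domImage X h βs) (domPenalty h) x : EReal) := by
    have hi := integrable_ballSup hε hfam hc' hc0 hx
    simp only [f, F_eq_coe hh _ (hc'.imp fun _ hi => hi.trans hx)]
    have hi' : Integrable
        (fun ω => ballSup (domImage X h βs) (domPenalty h) (ε ω) x - x ^ 2 / 2) P :=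
      hi.sub (integrable_const _)
    rw [extExpectation_coe hi', integral_sub hi (integrable_const _)]
    simp [meanCriterion]
  have hlt {x : ℝ} (hx : x < c) : f P ε X h βs x = ⊥ := by
    simp only [f, F_eq_bot _ fun β => hx.trans_le (hmin β)]
    exact extExpectation_bot
  constructor
  · rintro ⟨-, hmax⟩
    have hct : c ≤ t := by
      by_contra! hcon
      have := hmax (mem_Ici.2 hc0)
      simp only [mem_ofPred_eq, hlt hcon, hge le_rfl] at this
      simp at this
    refine ⟨hct, fun x hx => ?_⟩
    have := hmax (mem_Ici.2 (hc0.trans hx))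
    simp only [mem_ofPred_eq, hge hct, hge hx] at this
    exact EReal.coe_le_coe_iff.1 this
  · rintro ⟨hct, hmax⟩
    refine ⟨hc0.trans hct, fun x _ => ?_⟩
    simp only [mem_ofPred_eq]
    rcases lt_or_ge x c with hx | hx
    · rw [hlt hx]; exact bot_le
    · rw [hge hx, hge hct]; exact EReal.coe_le_coe_iff.2 (hmax hx)

end Bridge

end PenalizedLS

/-! ### Assembly and numerical constants -/

theorem mainTheorem4 {n p : ℕ} {Ω : Type*} [MeasurableSpace Ω]
    (P : Measure Ω) [IsProbabilityMeasure P]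
    (σ : ℝ) (hσ : 0 < σ)
    (ε : Ω → EuclideanSpace ℝ (Fin n))
    (hε : HasLaw ε (multivariateGaussian 0 (σ ^ 2 • (1 : Matrix (Fin n) (Fin n) ℝ))) P)
    (X : Matrix (Fin n) (Fin p) ℝ)
    (βs : EuclideanSpace ℝ (Fin p))
    (h : EuclideanSpace ℝ (Fin p) → ℝ≥0∞)
    (hh : PenalizedLS.IsPenalty n h)
    (htc : ∃ β₀ ∈ PenalizedLS.dom h,
      PenalizedLS.predError X βs β₀ = PenalizedLS.tc X h βs)
    (βhat : Ω → EuclideanSpace ℝ (Fin p))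
    (hβhat : ∀ ω, PenalizedLS.IsSolution X h (X.toEuclideanLin βs + ε ω) (βhat ω)) :
    (∃! tf : ℝ, PenalizedLS.IsMaximizer (PenalizedLS.f P ε X h βs) tf) ∧
    Integrable (fun ω => PenalizedLS.predError X βs (βhat ω)) P ∧
    ∀ tf : ℝ, PenalizedLS.IsMaximizer (PenalizedLS.f P ε X h βs) tf →
      (∀ m : ℝ, PenalizedLS.IsMedian P (fun ω => PenalizedLS.predError X βs (βhat ω)) m →
        |√tf - √m| ≤ √(21 * σ / 2) ∧ √(21 * σ / 2) ≤ 3.25 * √σ) ∧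
      |√tf - √(∫ ω, PenalizedLS.predError X βs (βhat ω) ∂P)|
        ≤ √σ * (√(21 / 2) + (Real.pi / 2) ^ (1 / 4 : ℝ)) ∧
      √σ * (√(21 / 2) + (Real.pi / 2) ^ (1 / 4 : ℝ)) ≤ 4.40 * √σ := by
  open PenalizedLS in
  have hfam : IsConvexFamily (domImage X h βs) (domPenalty h) := isConvexFamily_domImage hh.convex
  set c := tc X h βs with hc_def
  have hceq : ∃ β, ‖domImage X h βs β‖ = c := by
    obtain ⟨β₀, hd, heq⟩ := htc
    exact ⟨⟨β₀, hd⟩, heq⟩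
  have hc : ∃ β, ‖domImage X h βs β‖ ≤ c := hceq.imp fun _ => le_of_eq
  have hc0 : 0 ≤ c := by obtain ⟨β, hβ⟩ := hceq; exact hβ ▸ norm_nonneg _
  have hmin : ∀ β, c ≤ ‖domImage X h βs β‖ := fun β =>
    csInf_le ⟨0, by rintro _ ⟨β, -, rfl⟩; exact norm_nonneg _⟩ ⟨β.1, β.2, rfl⟩
  have hL := memLp_noise hε
  have hprox : ∀ e, ∃ i, IsProx (domImage X h βs) (domPenalty h) e i := fun e => by
    obtain ⟨b, hb⟩ := hh.solvable X (X.toEuclideanLin βs + e)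
    exact ⟨_, hb.isProx (hb.mem_dom hh.proper)⟩
  have hhat : ∀ ω, IsProx (domImage X h βs) (domPenalty h) (ε ω)
      ⟨βhat ω, (hβhat ω).mem_dom hh.proper⟩ := fun ω => (hβhat ω).isProx _
  obtain ⟨φ, hφ, hφeq⟩ := exists_lipschitzWith_norm_prox hfam hprox hhat
  have hpe : (fun ω => predError X βs (βhat ω)) = fun ω => φ (ε ω) := funext hφeq
  have hint : Integrable (fun ω => φ (ε ω)) P :=
    (memLp_two_of_lipschitz hL hφ).integrable one_le_two
  have hiff := isMaximizer_f_iff (X := X) (βs := βs) hh.convex hL hceq hmin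
  have hpi3 := Real.pi_gt_three
  have hpi := Real.pi_lt_d2
  have hsplit : √(21 * σ / 2) = √(21 / 2) * √σ := by
    rw [← Real.sqrt_mul (by norm_num)]; congr 1; ring
  have h105 : √(21 / 2) ≤ 3.25 := by
    rw [Real.sqrt_le_left (by norm_num)]; norm_num
  have hφ0 (ω) : 0 ≤ φ (ε ω) := hφeq ω ▸ norm_nonneg _
  have hm0 : ∀ m, IsMedian P (fun ω => φ (ε ω)) m → 0 ≤ m := fun m hm => by
    have h1 : P {ω | φ (ε ω) ≤ m} ≠ 0 := fun h0 => by simpa [h0] using hm.1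
    obtain ⟨ω, hω⟩ := nonempty_of_measure_ne_zero h1
    exact (hφ0 ω).trans hω
  have hmed : ∀ tf, IsMaximizer (f P ε X h βs) tf → ∀ m, IsMedian P (fun ω => φ (ε ω)) m →
      |√tf - √m| ≤ √(Real.pi * σ) := fun tf htf m hm => by
    obtain ⟨hct, hmax⟩ := (hiff tf).1 htf
    have hm' : IsMedian P (fun ω => predError X βs (βhat ω)) m := hpe ▸ hm
    exact abs_sqrt_sub_sqrt_le (hc0.trans hct) (hm0 m hm) (by positivity)
      (sq_sub_le_of_isMedian hσ hε hfam hc hmin hc0 hhat hct hmax hm')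
  rw [hpe]
  refine ⟨?_, hint, fun tf htf => ⟨fun m hm => ⟨?_, ?_⟩, ?_, ?_⟩⟩
  · obtain ⟨t, hct, hmax⟩ := exists_isMaxOn_meanCriterion hL hfam hc hc0 hmin hprox
    refine ⟨t, (hiff t).2 ⟨hct, hmax⟩, fun s hs => ?_⟩
    obtain ⟨hcs, hsmax⟩ := (hiff s).1 hs
    exact eq_of_isMaxOn_meanCriterion hL hfam hc hc0 hcs hct hsmax hmax
  -- The argument yields `√(πσ)`; only `π ≤ 21/2` is needed.
  · refine (hmed tf htf m hm).trans (Real.sqrt_le_sqrt ?_)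
    nlinarith
  · rw [hsplit]
    gcongr
  · obtain ⟨m, hm⟩ := exists_isMedian P hint.aemeasurable
    have h1 := hmed tf htf m hm
    have h2 := abs_median_sub_integral_le hσ hε hφ hm
    have h3 : |√m - √(∫ ω, φ (ε ω) ∂P)| ≤ √(Real.pi / 2 * σ) := by
      have hE : 0 ≤ ∫ ω, φ (ε ω) ∂P := integral_nonneg hφ0
      refine (abs_sqrt_sub_sqrt_le (hm0 m hm) hE (abs_nonneg _) ?_).trans (Real.sqrt_le_sqrt h2)
      rw [← sq_abs, pow_two]
      gcongr
      exact abs_le.2 ⟨by linarith [hm0 m hm], by linarith⟩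
    -- The two errors sum to at most `(1.8 + 1.3) √σ`, and `3.1 ≤ √(21/2)` already covers this.
    have h4 : √(Real.pi * σ) ≤ 1.8 * √σ := by
      rw [Real.sqrt_mul (by positivity)]
      gcongr
      rw [Real.sqrt_le_left (by norm_num)]; linarith
    have h5 : √(Real.pi / 2 * σ) ≤ 1.3 * √σ := by
      rw [Real.sqrt_mul (by positivity)]
      gcongr
      rw [Real.sqrt_le_left (by norm_num)]; linarith
    have h6 : (3.1 : ℝ) ≤ √(21 / 2) := Real.le_sqrt_of_sq_le (by norm_num)
    have h7 : 0 ≤ (Real.pi / 2) ^ (1 / 4 : ℝ) := by positivity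
    have h8 := abs_sub_le (√tf) (√m) (√(∫ ω, φ (ε ω) ∂P))
    have h9 : √σ * 3.1 ≤ √σ * (√(21 / 2) + (Real.pi / 2) ^ (1 / 4 : ℝ)) := by
      gcongr; linarith
    linarith
  · have h1 : (Real.pi / 2) ^ (1 / 4 : ℝ) ≤ 1.15 := by
      calc (Real.pi / 2) ^ (1 / 4 : ℝ) ≤ ((1.15 : ℝ) ^ 4) ^ (1 / 4 : ℝ) := by
            gcongr; norm_num; linarith
        _ = 1.15 := by
            rw [one_div]; exact_mod_cast Real.pow_rpow_inv_natCast (by norm_num) (by norm_num)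
    rw [mul_comm]
    gcongr
    linarith
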